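/- **Definitions.** Let $1<q<\infty$ and $a>0$. A Banach space $X$ is $q$-uniformly convex with constant $a$ if $\left\|\frac{x+y}{2}\right\|\le 1-a\varepsilon^q$ for all $\varepsilon>0$ and all $x,y\in X$ with $\|x\|=\|y\|=1$ and $\|x-y\|\ge\varepsilon$; it is $q$-uniformly convex if this holds for some $a>0$. The compression of a map $F:Y\to X$ between metric spaces is $\rho(t)=\inf_{d(y,y')\ge t} d(F(y),F(y'))\in[0,\infty]$ ($t>0$). $F$ is a uniform embedding if, for all sequences of pairs $(y_n,y_n')$ in $Y$, $d(y_n,y'_n)\to\infty$ if and only if $d(F(y_n),F(y'_n))\to\infty$. A function $\rho$ satisfies $(C_q)$ if $\int_1^\infty\left(\frac{\rho(t)}{t}\right)^q\frac{dt}{t}<\infty$. Trees are regarded as their vertex sets with the graph distance; $T_J$ denotes the binary rooted tree of depth $J$. An $L^p$-space is $L^p(\Omega,\mu)$ (real or complex) for an arbitrary measure space $(\Omega,\mu)$. **Theorem.** 1. For every $1<q<\infty$ and $a>0$ there is a constant $C=C(q,a)<\infty$ such that for every Banach space $X$ that is $q$-uniformly convex with constant $a$, every $J$ and every $1$-Lipschitz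 map $F:T_J\to X$ with compression $\rho$, $$\int_1^{2J}\left(\frac{\rho(t)}{t}\right)^q\frac{dt}{t}\le C,$$ and moreover, if $J\ge 2$, there are two distinct vertices $x,y$ of $T_J$ with $$\frac{\|F(x)-F(y)\|}{d(x,y)}\le\left(\frac{C}{\log J}\right)^{1/q}.$$ 2. If $F$ is a uniform embedding of the $3$-regular tree into a $q$-uniformly convex Banach space, $1<q<\infty$, then the compression of $F$ satisfies $(C_q)$. 3. Let $1<p<\infty$ and $q=\max\{p,2\}$. All $L^p$-spaces are $q$-uniformly convex, with a constant $a>0$ depending only on $p$. There is a constant $C<\infty$ depending only on $p$ such that for every $J$ and every $1$-Lipschitz map $F$ from $T_J$ to an $L^p$-space, with compression $\rho$, $\int_1^{2J}\left(\frac{\rho(t)}{t}\right)^q\frac{dt}{t}\le C$. The compression of every uniform embedding of the $3$-regular tree into an $L^p$-space satisfies $(C_q)$. -/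

import Mathlib

open MeasureTheory Filter
open scoped NNReal ENNReal

/-- The metric on the vertex set of a connected graph given by the length of shortest paths. -/
@[reducible] noncomputable def graphMetricSpace {V : Type*} (G : SimpleGraph V) (hG : G.Connected) :
    MetricSpace V where
  dist u v := (G.dist u v : ℝ)
  dist_self u := by simp
  dist_comm u v := by simp [SimpleGraph.dist_comm]
  dist_triangle u v w := by exact_mod_cast hG.dist_triangle
  eq_of_dist_eq_zero {u v} h := by
    have h0 : G.dist u v = 0 := by exact_mod_cast h
    exact (hG.dist_eq_zero_iff).1 h0

/-- Vertices of the binary rooted tree of depth `J`: words of length at most `J` in two letters;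
the empty word is the root. -/
def RootedBinaryTree (J : ℕ) : Type := {l : List Bool // l.length ≤ J}

/-- The edges of the binary rooted tree join each word `l` to its children `b :: l`. -/
def rootedBinaryTreeGraph (J : ℕ) : SimpleGraph (RootedBinaryTree J) :=
  SimpleGraph.fromRel fun u v => ∃ b : Bool, v.1 = b :: u.1

theorem rootedBinaryTreeGraph_reachable_root (J : ℕ) (l : List Bool) (h : l.length ≤ J) :
    (rootedBinaryTreeGraph J).Reachable ⟨[], Nat.zero_le J⟩ ⟨l, h⟩ := by
  induction l with
  | nil => exact SimpleGraph.Reachable.refl _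
  | cons b l ih =>
    have hl : l.length ≤ J := by simp at h; omega
    refine (ih hl).trans (SimpleGraph.Adj.reachable ?_)
    refine (SimpleGraph.fromRel_adj _ _ _).2 ⟨?_, Or.inl ⟨b, rfl⟩⟩
    intro he
    exact List.cons_ne_self b l (congrArg Subtype.val he).symm

theorem rootedBinaryTreeGraph_connected (J : ℕ) : (rootedBinaryTreeGraph J).Connected where
  preconnected u v :=
    (rootedBinaryTreeGraph_reachable_root J u.1 u.2).symm.trans
      (rootedBinaryTreeGraph_reachable_root J v.1 v.2)
  nonempty := ⟨⟨[], Nat.zero_le J⟩⟩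

/-- The binary rooted tree of depth `J` carries its graph distance. -/
noncomputable instance (J : ℕ) : MetricSpace (RootedBinaryTree J) :=
  graphMetricSpace (rootedBinaryTreeGraph J) (rootedBinaryTreeGraph_connected J)

/-- The compression of a map between metric spaces, with values in `[0, ∞]` (the infimum over the
empty set is `∞`). -/
noncomputable def compression {X Y : Type*} [PseudoMetricSpace X] [PseudoMetricSpace Y]
    (F : X → Y) (t : ℝ) : ℝ≥0∞ :=
  ⨅ (x : X) (y : X) (_ : t ≤ dist x y), edist (F x) (F y)

/-- Uniform embedding in the large-scale sense: `d (x, y) → ∞` if and only if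
`d (F x, F y) → ∞`, along sequences of pairs of points. -/
def IsUniformEmbeddingLS {X Y : Type*} [PseudoMetricSpace X] [PseudoMetricSpace Y]
    (F : X → Y) : Prop :=
  ∀ x y : ℕ → X,
    Tendsto (fun n => dist (x n) (y n)) atTop atTop ↔
      Tendsto (fun n => dist (F (x n)) (F (y n))) atTop atTop

/-- `X` is `q`-uniformly convex with constant `a`. -/
def UniformlyConvexWith (q a : ℝ) (X : Type*) [NormedAddCommGroup X] [NormedSpace ℝ X] : Prop :=
  ∀ ε : ℝ, 0 < ε → ∀ x y : X, ‖x‖ = 1 → ‖y‖ = 1 → ε ≤ ‖x - y‖ →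
    ‖(1 / 2 : ℝ) • (x + y)‖ ≤ 1 - a * ε ^ q

/-- `X` is `q`-uniformly convex. -/
def QUniformlyConvex (q : ℝ) (X : Type*) [NormedAddCommGroup X] [NormedSpace ℝ X] : Prop :=
  ∃ a : ℝ, 0 < a ∧ UniformlyConvexWith q a X

/-- The integral of `(ρ t / t) ^ q * (1 / t)` over the set `s`, which lies in `(0, ∞)` in all uses
below. -/
noncomputable def scaleIntegral (q : ℝ) (ρ : ℝ → ℝ≥0∞) (s : Set ℝ) : ℝ≥0∞ :=
  ∫⁻ t in s, (ρ t / ENNReal.ofReal t) ^ q / ENNReal.ofReal t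

/-- Condition `(C_q)`. -/
def ConditionC (q : ℝ) (ρ : ℝ → ℝ≥0∞) : Prop :=
  scaleIntegral q ρ (Set.Ici 1) < ∞

/-!
The binary tree of depth `J` is tested against uniform convexity at its forks, one dyadic scale at a
time. A fork is a vertex `u`, a descendant `v` of `u`, and two descendants `w`, `w'` of `v` in
different directions, all at vertical distance `2 ^ k`. If `F` has Lipschitz constant `L ≤ 1` at
this scale and `F w`, `F w'` are `r * 2 ^ (k + 1)` apart, then the normalized increment of `F` from
`u` to `v` differs by at least `r` from that from `v` to `w` or to `w'`; by uniform convexity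
`‖F w - F u‖` (or the same with `w'`) is at most `2 ^ (k + 1) * (L - c * r ^ q)`, where `c` depends
only on `q` and `a` (`UniformlyConvexWith.exists_branch`).

Keeping the better tip of every such fork leaves a binary tree of half the depth, whose distances
are doubled and on which the rescaled `F` has Lipschitz constant `L - c * r ^ q`
(`IsDyadicSubtree.exists_succ`). Iteration over the scales `2 ^ k ≤ J / 2` starting from `L = 1`
gives `c * ∑ k, r k ^ q ≤ 1`, since Lipschitz constants are nonnegative
(`UniformlyConvexWith.sum_tree_le`). With `r k = ρ (2 ^ (k + 1)) / 2 ^ (k + 1)` the sum dominates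
the scale integral up to the two topmost scales, which contribute a bounded amount
(`UniformlyConvexWith.scaleIntegral_le`). With `r` constant it yields two vertices whose distance
is contracted by a power of `log J` (`UniformlyConvexWith.exists_div_dist_le`).

A `3`-regular tree contains isometric copies of all binary trees
(`exists_isometry_rootedBinaryTree`), a uniform embedding of it is Lipschitz, and the bound
for finite trees does not depend on the depth; hence `QUniformlyConvex.conditionC`.

For `L^p` (`uniformlyConvexWith_Lp`), pointwise inequalities between `p`-th powers of the four
lengths in a parallelogram are integrated: Clarkson's inequality if `p ≥ 2`, and a quantitative form
of the convexity of `‖·‖ ^ p` with a free parameter (`rpow_le_of_le_two`) if `p < 2`.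
-/

/-! ### Uniform convexity and forks -/

/-- Uniform convexity for two vectors of the unit ball instead of the unit sphere. -/
theorem UniformlyConvexWith.norm_half_add_le {q a : ℝ} (hq : 1 < q) (ha : 0 < a)
    {X : Type*} [NormedAddCommGroup X] [NormedSpace ℝ X] (hX : UniformlyConvexWith q a X)
    {x y : X} (hx : ‖x‖ ≤ 1) (hy : ‖y‖ ≤ 1) {ε : ℝ} (hε : 0 ≤ ε) (hxy : ε ≤ ‖x - y‖) :
    ‖(1 / 2 : ℝ) • (x + y)‖ ≤ 1 - min (a / 2) (1 / 4) * (ε / 2) ^ q := by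
  wlog hyx : ‖y‖ ≤ ‖x‖ generalizing x y
  · rw [add_comm]
    exact this hy hx (by rwa [norm_sub_rev]) (le_of_not_ge hyx)
  have hε2 : ε / 2 ≤ 1 := by linarith [norm_sub_le x y]
  have hc : 0 ≤ min (a / 2) (1 / 4) := by positivity
  have htri : ‖(1 / 2 : ℝ) • (x + y)‖ ≤ (‖x‖ + ‖y‖) / 2 := by
    rw [norm_smul, Real.norm_of_nonneg (by norm_num)]
    linarith [norm_add_le x y]
  rcases hε.eq_or_lt with rfl | hεpos
  · rw [zero_div, Real.zero_rpow (by linarith)]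
    linarith
  rcases le_total ‖y‖ (1 - ε / 4) with h | h
  · -- one of the two vectors is short, and the triangle inequality suffices
    have h1 : (ε / 2) ^ q ≤ ε / 2 := by
      simpa using Real.rpow_le_rpow_of_exponent_ge (by positivity) hε2 hq.le
    have h2 : min (a / 2) (1 / 4) * (ε / 2) ^ q ≤ 1 / 4 * (ε / 2) :=
      mul_le_mul (min_le_right _ _) h1 (by positivity) (by norm_num)
    linarith
  · -- both vectors are long, and their normalizations are still far apart
    have hy0 : 0 < ‖y‖ := by linarith
    have hx0 : 0 < ‖x‖ := by linarith
    have hn : ∀ z : X, 0 < ‖z‖ → ‖‖z‖⁻¹ • z‖ = 1 := fun z hz => by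
      rw [norm_smul, norm_inv, norm_norm, inv_mul_cancel₀ hz.ne']
    have hd : ∀ z : X, 0 < ‖z‖ → ‖z‖ ≤ 1 → ‖z - ‖z‖⁻¹ • z‖ = 1 - ‖z‖ := fun z hz hz1 => by
      have : z - ‖z‖⁻¹ • z = (1 - ‖z‖⁻¹) • z := by rw [sub_smul, one_smul]
      have h3 : 1 ≤ ‖z‖⁻¹ := (one_le_inv₀ hz).2 hz1
      rw [this, norm_smul, Real.norm_of_nonpos (by linarith), neg_sub, sub_mul, one_mul,
        inv_mul_cancel₀ hz.ne']
    have hsep : ε / 2 ≤ ‖‖x‖⁻¹ • x - ‖y‖⁻¹ • y‖ := by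
      have e : x - y = (x - ‖x‖⁻¹ • x) + (‖x‖⁻¹ • x - ‖y‖⁻¹ • y) - (y - ‖y‖⁻¹ • y) := by abel
      have h3 := norm_sub_le ((x - ‖x‖⁻¹ • x) + (‖x‖⁻¹ • x - ‖y‖⁻¹ • y)) (y - ‖y‖⁻¹ • y)
      have h4 := norm_add_le (x - ‖x‖⁻¹ • x) (‖x‖⁻¹ • x - ‖y‖⁻¹ • y)
      rw [← e, hd y hy0 hy] at h3
      rw [hd x hx0 hx] at h4
      linarith
    have hu := hX _ (by positivity) _ _ (hn x hx0) (hn y hy0) hsep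
    have e : (1 / 2 : ℝ) • (x + y) = ‖y‖ • ((1 / 2 : ℝ) • (‖x‖⁻¹ • x + ‖y‖⁻¹ • y)) +
        ((‖x‖ - ‖y‖) / 2) • (‖x‖⁻¹ • x) := by
      have h5 : ‖x‖ • (‖x‖⁻¹ • x) = x := by rw [smul_smul, mul_inv_cancel₀ hx0.ne', one_smul]
      have h6 : ‖y‖ • (‖y‖⁻¹ • y) = y := by rw [smul_smul, mul_inv_cancel₀ hy0.ne', one_smul]
      conv_lhs => rw [← h5, ← h6]
      module
    have h7 := norm_add_le (‖y‖ • ((1 / 2 : ℝ) • (‖x‖⁻¹ • x + ‖y‖⁻¹ • y)))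
      (((‖x‖ - ‖y‖) / 2) • (‖x‖⁻¹ • x))
    rw [← e, norm_smul _ (‖x‖⁻¹ • x), norm_smul ‖y‖, norm_norm, hn x hx0,
      Real.norm_of_nonneg (by linarith)] at h7
    have h8 := mul_le_mul_of_nonneg_left hu hy0.le
    have h9 : 0 ≤ a * (ε / 2) ^ q := by positivity
    have h10 : min (a / 2) (1 / 4) * (ε / 2) ^ q ≤ a / 2 * (ε / 2) ^ q :=
      mul_le_mul_of_nonneg_right (min_le_left _ _) (by positivity)
    nlinarith

/-- The constant with which unit vectors may be replaced by vectors of the unit ball in the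
definition of uniform convexity. -/
noncomputable def ballConvexityConst (q a : ℝ) : ℝ := min (a / 2) (1 / 4) / 2 ^ q

theorem ballConvexityConst_pos {q a : ℝ} (ha : 0 < a) : 0 < ballConvexityConst q a := by
  unfold ballConvexityConst
  positivity

/-- Uniform convexity on a ball of radius `L ≤ 1`. The homogeneous form of the deficit is
`c * r ^ q * L ^ (1 - q)`, and the last factor is at least one because `q ≥ 1`. -/
theorem UniformlyConvexWith.norm_half_add_le_sub {q a : ℝ} (hq : 1 < q) (ha : 0 < a)
    {X : Type*} [NormedAddCommGroup X] [NormedSpace ℝ X] (hX : UniformlyConvexWith q a X)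
    {x y : X} {L r : ℝ} (hL : L ≤ 1) (hx : ‖x‖ ≤ L) (hy : ‖y‖ ≤ L) (hr : 0 ≤ r)
    (hxy : r ≤ ‖x - y‖) :
    ‖(1 / 2 : ℝ) • (x + y)‖ ≤ L - ballConvexityConst q a * r ^ q := by
  have hc := (ballConvexityConst_pos (q := q) ha).le
  rcases ((norm_nonneg x).trans hx).eq_or_lt with rfl | hL0
  · have hx0 := norm_le_zero_iff.1 hx
    have hy0 := norm_le_zero_iff.1 hy
    subst hx0 hy0
    have : r = 0 := le_antisymm (by simpa using hxy) hr
    rw [this, Real.zero_rpow (by linarith)]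
    simp
  have hs : ∀ z : X, ‖L⁻¹ • z‖ = L⁻¹ * ‖z‖ := fun z => by
    rw [norm_smul, Real.norm_of_nonneg (by positivity)]
  have hs1 : ∀ z : X, ‖z‖ ≤ L → ‖L⁻¹ • z‖ ≤ 1 := fun z hz => by
    rw [hs, inv_mul_le_iff₀ hL0, mul_one]; exact hz
  have h := hX.norm_half_add_le hq ha (hs1 x hx) (hs1 y hy) (ε := L⁻¹ * r) (by positivity)
    (by rw [← smul_sub, hs]; gcongr)
  rw [← smul_add, smul_comm, hs, inv_mul_le_iff₀ hL0] at h
  refine h.trans ?_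
  have e : min (a / 2) (1 / 4) * (L⁻¹ * r / 2) ^ q =
      ballConvexityConst q a * r ^ q * (L ^ q)⁻¹ := by
    rw [ballConvexityConst, Real.div_rpow (by positivity) (by norm_num),
      Real.mul_rpow (by positivity) hr, Real.inv_rpow hL0.le]
    ring
  rw [e, mul_sub, mul_one]
  have h1 : L ^ q ≤ L := by simpa using Real.rpow_le_rpow_of_exponent_ge hL0 hL hq.le
  have h2 : 1 ≤ L * (L ^ q)⁻¹ := by
    rw [← div_eq_mul_inv, le_div_iff₀ (by positivity), one_mul]; exact h1
  have h3 : 0 ≤ ballConvexityConst q a * r ^ q := by positivity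
  nlinarith

/-- From the two branches of a fork, one can be kept along which the average of the two steps is
shorter than each of them is allowed to be. -/
theorem UniformlyConvexWith.exists_branch {q a : ℝ} (hq : 1 < q) (ha : 0 < a)
    {X : Type*} [NormedAddCommGroup X] [NormedSpace ℝ X] (hX : UniformlyConvexWith q a X)
    {L r s : ℝ} (hL : L ≤ 1) (hr : 0 ≤ r) (hs : 0 < s) (u v : X) (w : Bool → X)
    (huv : ‖v - u‖ ≤ s * L) (hvw : ∀ g, ‖w g - v‖ ≤ s * L)
    (hw : r * (s * 2) ≤ ‖w true - w false‖) :
    ∃ g, ‖w g - u‖ ≤ s * 2 * (L - ballConvexityConst q a * r ^ q) := by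
  have hn : ∀ z : X, ‖s⁻¹ • z‖ = s⁻¹ * ‖z‖ := fun z => by
    rw [norm_smul, Real.norm_of_nonneg (by positivity)]
  have hn1 : ∀ z : X, ‖z‖ ≤ s * L → ‖s⁻¹ • z‖ ≤ L := fun z hz => by
    rw [hn, inv_mul_le_iff₀ hs]; exact hz
  have key : ∀ g, r ≤ ‖s⁻¹ • (v - u) - s⁻¹ • (w g - v)‖ →
      ∃ g, ‖w g - u‖ ≤ s * 2 * (L - ballConvexityConst q a * r ^ q) := fun g hg => by
    refine ⟨g, ?_⟩
    have h := hX.norm_half_add_le_sub hq ha hL (hn1 _ huv) (hn1 _ (hvw g)) hr hg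
    rw [← smul_add, smul_comm, hn, inv_mul_le_iff₀ hs, norm_smul,
      Real.norm_of_nonneg (by norm_num), sub_add_sub_cancel'] at h
    linarith
  -- `v - u` cannot be close to both `w true - v` and `w false - v`, which are `2 * s * r` apart
  by_contra hcon
  have h1 := not_le.1 fun h => hcon (key true h)
  have h2 := not_le.1 fun h => hcon (key false h)
  have h3 := norm_sub_le (s⁻¹ • (v - u) - s⁻¹ • (w false - v))
    (s⁻¹ • (v - u) - s⁻¹ • (w true - v))
  rw [sub_sub_sub_cancel_left, ← smul_sub, sub_sub_sub_cancel_right, hn] at h3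
  have h4 : s⁻¹ * (r * (s * 2)) ≤ s⁻¹ * ‖w true - w false‖ := by gcongr
  have h5 : s⁻¹ * (r * (s * 2)) = 2 * r := by field_simp
  linarith

/-- A selection `σ` of vertices at the heights divisible by `2 ^ k`, on which the map `G` has, up to
height `N` and after rescaling by `2 ^ k`, Lipschitz constant at most `L`. The selected vertices form
a binary tree: the path from `σ l` up to `σ (b :: l)` starts in the direction `b`, and the
remaining `2 ^ k - 1` letters are arbitrary. -/
structure IsDyadicSubtree {X : Type*} [NormedAddCommGroup X] (G : List Bool → X) (N k : ℕ) (L : ℝ)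
    (σ : List Bool → List Bool) : Prop where
  map_nil : σ [] = []
  map_cons : ∀ b l, ∃ w : List Bool, w.length = 2 ^ k - 1 ∧ σ (b :: l) = w ++ b :: σ l
  norm_le : ∀ b l, 2 ^ k * (l.length + 1) ≤ N → ‖G (σ (b :: l)) - G (σ l)‖ ≤ 2 ^ k * L

theorem IsDyadicSubtree.length {X : Type*} [NormedAddCommGroup X] {G : List Bool → X} {N k : ℕ}
    {L : ℝ} {σ : List Bool → List Bool} (h : IsDyadicSubtree G N k L σ) (l : List Bool) :
    (σ l).length = 2 ^ k * l.length := by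
  induction l with
  | nil => simp [h.map_nil]
  | cons b l ih =>
    obtain ⟨w, hw, e⟩ := h.map_cons b l
    have := Nat.one_le_two_pow (n := k)
    rw [e, List.length_append, List.length_cons, ih, hw, List.length_cons, mul_add]
    omega

/-- The words that branch as prescribed at every other letter, the letters in between being
chosen by `g`. -/
def everyOther (g : Bool → List Bool → Bool) : List Bool → List Bool
  | [] => []
  | b :: l => g b (everyOther g l) :: b :: everyOther g l

theorem length_everyOther (g : Bool → List Bool → Bool) (l : List Bool) :
    (everyOther g l).length = 2 * l.length := by
  induction l with
  | nil => rfl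
  | cons b l ih => simp only [everyOther, List.length_cons, ih]; ring

/-- One step of the construction: every other generation is dropped, and of the two grandchildren
that descend from the same child the one provided by `UniformlyConvexWith.exists_branch` is kept.
Kept grandchildren of the same vertex still branch off at that vertex, so the rescaled
distances are again those of a binary tree. -/
theorem IsDyadicSubtree.exists_succ {q a : ℝ} (hq : 1 < q) (ha : 0 < a)
    {X : Type*} [NormedAddCommGroup X] [NormedSpace ℝ X] (hX : UniformlyConvexWith q a X)
    {G : List Bool → X} {N k : ℕ} {L r : ℝ} {σ : List Bool → List Bool}
    (h : IsDyadicSubtree G N k L σ) (hL : L ≤ 1) (hr : 0 ≤ r)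
    (hG : ∀ w w' m : List Bool, w.length = 2 ^ k - 1 → w'.length = 2 ^ k - 1 →
      2 ^ k + m.length ≤ N → r * 2 ^ (k + 1) ≤ ‖G (w ++ true :: m) - G (w' ++ false :: m)‖) :
    ∃ σ', IsDyadicSubtree G N (k + 1) (L - ballConvexityConst q a * r ^ q) σ' := by
  have hsel : ∀ (b : Bool) (l : List Bool), ∃ g : Bool, 2 ^ k * (l.length + 2) ≤ N →
      ‖G (σ (g :: b :: l)) - G (σ l)‖ ≤ 2 ^ k * 2 * (L - ballConvexityConst q a * r ^ q) := by
    intro b l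
    by_cases hN : 2 ^ k * (l.length + 2) ≤ N
    · have hN' : 2 ^ k * (l.length + 1) ≤ N := le_trans (by gcongr; norm_num) hN
      obtain ⟨g, hg⟩ := hX.exists_branch hq ha hL hr (s := 2 ^ k) (by positivity)
        (G (σ l)) (G (σ (b :: l))) (fun g => G (σ (g :: b :: l))) (h.norm_le b l hN')
        (fun g => h.norm_le g (b :: l) (by simpa using hN)) (by
          obtain ⟨w, hw, e⟩ := h.map_cons true (b :: l)
          obtain ⟨w', hw', e'⟩ := h.map_cons false (b :: l)
          rw [e, e', ← pow_succ]
          refine hG w w' _ hw hw' (le_trans (le_of_eq ?_) hN)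
          rw [h.length, List.length_cons]; ring)
      exact ⟨g, fun _ => hg⟩
    · exact ⟨true, fun h => absurd h hN⟩
  choose g hg using hsel
  refine ⟨fun l => σ (everyOther g l), h.map_nil, fun b l => ?_, fun b l hN => ?_⟩
  · obtain ⟨w, hw, e⟩ := h.map_cons (g b (everyOther g l)) (b :: everyOther g l)
    obtain ⟨w', hw', e'⟩ := h.map_cons b (everyOther g l)
    refine ⟨w ++ g b (everyOther g l) :: w', ?_, ?_⟩
    · have := Nat.one_le_two_pow (n := k)
      rw [List.length_append, List.length_cons, hw, hw', pow_succ]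
      omega
    · simp only [everyOther]
      rw [e, e', List.append_assoc, List.cons_append]
  · rw [pow_succ]
    refine hg b _ (le_trans (le_of_eq ?_) hN)
    rw [length_everyOther]; ring

/-- The multiscale inequality: forks at the scales `2 ^ k`, `k < K`, whose tips are separated by
`r k * 2 ^ (k + 1)`, cost `r k ^ q` each, and the total cost is bounded. -/
theorem UniformlyConvexWith.sum_fork_le {q a : ℝ} (hq : 1 < q) (ha : 0 < a)
    {X : Type*} [NormedAddCommGroup X] [NormedSpace ℝ X] (hX : UniformlyConvexWith q a X)
    (G : List Bool → X) (K : ℕ) (r : ℕ → ℝ) (hr : ∀ k, 0 ≤ r k)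
    (hlip : ∀ b l, l.length + 1 ≤ 2 ^ K → ‖G (b :: l) - G l‖ ≤ 1)
    (hG : ∀ k < K, ∀ w w' m : List Bool, w.length = 2 ^ k - 1 → w'.length = 2 ^ k - 1 →
      2 ^ k + m.length ≤ 2 ^ K →
      r k * 2 ^ (k + 1) ≤ ‖G (w ++ true :: m) - G (w' ++ false :: m)‖) :
    ballConvexityConst q a * ∑ k ∈ Finset.range K, r k ^ q ≤ 1 := by
  have hc := (ballConvexityConst_pos (q := q) ha).le
  have key : ∀ k ≤ K, ∃ σ, IsDyadicSubtree G (2 ^ K) k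
      (1 - ballConvexityConst q a * ∑ j ∈ Finset.range k, r j ^ q) σ := by
    intro k
    induction k with
    | zero => exact fun _ => ⟨id, rfl, fun b l => ⟨[], rfl, rfl⟩, fun b l hN => by
        simpa using hlip b l (by simpa using hN)⟩
    | succ k ih =>
      intro hk
      obtain ⟨σ, hσ⟩ := ih (by omega)
      have h0 : 0 ≤ ∑ j ∈ Finset.range k, r j ^ q :=
        Finset.sum_nonneg fun j _ => Real.rpow_nonneg (hr j) q
      obtain ⟨σ', h'⟩ := hσ.exists_succ hq ha hX (by nlinarith) (hr k) (hG k (by omega))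
      refine ⟨σ', ?_⟩
      rwa [Finset.sum_range_succ, mul_add, ← sub_sub]
  obtain ⟨σ, hσ⟩ := key K le_rfl
  have h := (norm_nonneg _).trans (hσ.norm_le true [] (by simp))
  have h2 := nonneg_of_mul_nonneg_right h (by positivity)
  linarith

/-! ### Binary trees and the scale integral -/

theorem dist_map_le_of_adj {V Y : Type*} [PseudoMetricSpace Y] {G : SimpleGraph V}
    (hG : G.Connected) {h : V → Y} {L : ℝ} (hadj : ∀ u v, G.Adj u v → dist (h u) (h v) ≤ L)
    (u v : V) : dist (h u) (h v) ≤ L * G.dist u v := by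
  obtain ⟨p, hp⟩ := hG.exists_walk_length_eq_dist u v
  rw [← hp]
  clear hp
  induction p with
  | nil => simp
  | @cons a b c hab p ih =>
    rw [SimpleGraph.Walk.length_cons, Nat.cast_add, Nat.cast_one]
    linarith [dist_triangle (h a) (h b) (h c), hadj _ _ hab]

namespace RootedBinaryTree

theorem dist_eq {J : ℕ} (x y : RootedBinaryTree J) :
    dist x y = ((rootedBinaryTreeGraph J).dist x y : ℝ) := rfl

/-- The vertex given by a word of length at most `J`. -/
def ofWord {J : ℕ} (l : List Bool) (h : l.length ≤ J) : RootedBinaryTree J := ⟨l, h⟩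

theorem adj_cons {J : ℕ} (b : Bool) (l : List Bool) (h : (b :: l).length ≤ J)
    (h' : l.length ≤ J) : (rootedBinaryTreeGraph J).Adj (ofWord (b :: l) h) (ofWord l h') :=
  (SimpleGraph.fromRel_adj _ _ _).2
    ⟨fun he => List.cons_ne_self b l (congrArg Subtype.val he), Or.inr ⟨b, rfl⟩⟩

theorem dist_cons_le {J : ℕ} (b : Bool) (l : List Bool) (h : (b :: l).length ≤ J)
    (h' : l.length ≤ J) : dist (ofWord (b :: l) h) (ofWord l h') ≤ 1 := by
  rw [dist_eq, SimpleGraph.dist_eq_one_iff_adj.2 (adj_cons b l h h'), Nat.cast_one]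

theorem dist_root_le {J : ℕ} (l : List Bool) (h : l.length ≤ J) :
    dist (ofWord l h) (ofWord [] (Nat.zero_le J)) ≤ l.length := by
  induction l with
  | nil => simp
  | cons b l ih =>
    have hl : l.length ≤ J := by simp at h; omega
    refine (dist_triangle _ (ofWord l hl) _).trans ?_
    rw [List.length_cons, Nat.cast_add, Nat.cast_one]
    linarith [ih hl, dist_cons_le b l h hl]

theorem dist_le {J : ℕ} (x y : RootedBinaryTree J) : dist x y ≤ 2 * J := by
  have hx := dist_root_le x.1 x.2
  have hy := dist_root_le y.1 y.2
  have h := dist_triangle_right (ofWord x.1 x.2) (ofWord y.1 y.2) (ofWord [] (Nat.zero_le J))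
  have hx' : (x.1.length : ℝ) ≤ J := by exact_mod_cast x.2
  have hy' : (y.1.length : ℝ) ≤ J := by exact_mod_cast y.2
  exact h.trans (by linarith)

/-- Two words that branch off from `m` in different directions are as far apart as their lengths
suggest. The proof compares the values at the two words of a function that changes by at most one
along each edge: the height above `m` on the `true` side of the fork, and minus that height
elsewhere. -/
theorem le_dist_fork {J : ℕ} (w w' m : List Bool) (h : (w ++ true :: m).length ≤ J)
    (h' : (w' ++ false :: m).length ≤ J) :
    ((w.length + w'.length + 2 : ℕ) : ℝ) ≤
      dist (ofWord (w ++ true :: m) h) (ofWord (w' ++ false :: m) h') := by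
  classical
  let φ : List Bool → ℝ := fun u =>
    if (true :: m) <:+ u then (u.length : ℝ) else 2 * m.length - u.length
  have hstep : ∀ (b : Bool) (l : List Bool), |φ (b :: l) - φ l| ≤ 1 := by
    intro b l
    by_cases h1 : (true :: m) <:+ l
    · have h2 : (true :: m) <:+ b :: l := h1.trans (List.suffix_cons b l)
      simp [φ, h1, h2]
    · by_cases h2 : (true :: m) <:+ b :: l
      · rcases List.suffix_cons_iff.1 h2 with h3 | h3
        · obtain ⟨rfl, rfl⟩ := List.cons.inj h3
          simp only [φ, h1, h2, if_true, if_false, List.length_cons]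
          push_cast
          rw [abs_le]; constructor <;> linarith
        · exact absurd h3 h1
      · simp only [φ, h1, h2, if_false, List.length_cons]
        push_cast
        rw [abs_le]; constructor <;> linarith
  have key := dist_map_le_of_adj (rootedBinaryTreeGraph_connected J) (h := fun u => φ u.1) (L := 1) (by
    intro u v huv
    rcases ((SimpleGraph.fromRel_adj _ _ _).1 huv).2 with ⟨b, hb⟩ | ⟨b, hb⟩
    · rw [hb, dist_comm]; exact hstep b _
    · rw [hb]; exact hstep b _) (ofWord (w ++ true :: m) h) (ofWord (w' ++ false :: m) h')
  have e1 : φ (w ++ true :: m) = w.length + 1 + m.length := by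
    have : (true :: m) <:+ w ++ true :: m := List.suffix_append _ _
    simp only [φ, this, if_true, List.length_append, List.length_cons]
    push_cast; ring
  have e2 : φ (w' ++ false :: m) = m.length - w'.length - 1 := by
    have : ¬ (true :: m) <:+ w' ++ false :: m := by
      intro hs
      have h3 := List.suffix_of_suffix_length_le hs (List.suffix_append w' (false :: m)) (by simp)
      have h4 := h3.eq_of_length (by simp)
      simp at h4
    simp only [φ, this, if_false, List.length_append, List.length_cons]
    push_cast; ring
  change |φ (w ++ true :: m) - φ (w' ++ false :: m)| ≤ _ at key
  rw [e1, e2, one_mul] at key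
  rw [dist_eq]
  push_cast
  linarith [(le_abs_self _).trans key]

end RootedBinaryTree

theorem compression_le {X Y : Type*} [PseudoMetricSpace X] [PseudoMetricSpace Y]
    (F : X → Y) {t : ℝ} {x y : X} (h : t ≤ dist x y) : compression F t ≤ edist (F x) (F y) :=
  iInf_le_of_le x (iInf_le_of_le y (iInf_le _ h))

theorem compression_mono {X Y : Type*} [PseudoMetricSpace X] [PseudoMetricSpace Y]
    (F : X → Y) : Monotone (compression F) := fun _ _ hst =>
  le_iInf fun _ => le_iInf fun _ => le_iInf fun h => compression_le F (hst.trans h)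

theorem compression_rootedBinaryTree_le {J : ℕ} {Y : Type*} [PseudoMetricSpace Y]
    {F : RootedBinaryTree J → Y} (hF : LipschitzWith 1 F) {t : ℝ} (ht : t ≤ 2 * J) :
    compression F t ≤ ENNReal.ofReal (2 * J) := by
  have hle : ∀ x y : RootedBinaryTree J, edist (F x) (F y) ≤ ENNReal.ofReal (2 * J) := fun x y => by
    rw [edist_dist]
    refine ENNReal.ofReal_le_ofReal (((hF.dist_le_mul x y).trans ?_))
    simpa using RootedBinaryTree.dist_le x y
  rcases J with _ | J
  · let x : RootedBinaryTree 0 := .ofWord [] le_rfl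
    exact (compression_le F (x := x) (y := x) (by simpa using ht)).trans (hle _ _)
  · have h : (List.replicate J true ++ true :: []).length ≤ J + 1 := by simp
    have h' : (List.replicate J true ++ false :: []).length ≤ J + 1 := by simp
    refine (compression_le F (ht.trans (le_trans (le_of_eq ?_)
      (RootedBinaryTree.le_dist_fork _ _ _ h h')))).trans (hle _ _)
    simp only [List.length_replicate]
    push_cast; ring

theorem UniformlyConvexWith.sum_tree_le {q a : ℝ} (hq : 1 < q) (ha : 0 < a)
    {X : Type*} [NormedAddCommGroup X] [NormedSpace ℝ X] (hX : UniformlyConvexWith q a X)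
    {J K : ℕ} (hK : 2 ^ K ≤ J) {F : RootedBinaryTree J → X} (hF : LipschitzWith 1 F)
    (r : ℕ → ℝ) (hr : ∀ k, 0 ≤ r k)
    (h : ∀ k < K, ∀ x y, 2 ^ (k + 1) ≤ dist x y → r k * 2 ^ (k + 1) ≤ ‖F x - F y‖) :
    ballConvexityConst q a * ∑ k ∈ Finset.range K, r k ^ q ≤ 1 := by
  refine hX.sum_fork_le hq ha (fun l => if hl : l.length ≤ J then F (.ofWord l hl) else 0) K r hr ?_ ?_
  · intro b l hl
    have h1 : (b :: l).length ≤ J := by simpa using hl.trans hK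
    have h2 : l.length ≤ J := by omega
    simp only [h1, h2, dif_pos]
    rw [← dist_eq_norm]
    simpa using (hF.dist_le_mul _ _).trans
      (mul_le_mul_of_nonneg_left (RootedBinaryTree.dist_cons_le b l h1 h2) zero_le_one)
  · intro k hk w w' m hw hw' hN
    have hpow := Nat.one_le_two_pow (n := k)
    have h1 : (w ++ true :: m).length ≤ J := by simp; omega
    have h2 : (w' ++ false :: m).length ≤ J := by simp; omega
    simp only [h1, h2, dif_pos]
    refine h k hk _ _ (le_trans (le_of_eq ?_) (RootedBinaryTree.le_dist_fork w w' m h1 h2))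
    have : w.length + w'.length + 2 = 2 ^ (k + 1) := by rw [pow_succ]; omega
    rw [this]; push_cast; rfl

/-- On the scales between `s` and `2 * s` the measure `dt / t` has mass at most one. -/
theorem scaleIntegral_dyadic_le {q : ℝ} (hq : 0 < q) {ρ : ℝ → ℝ≥0∞} {s T : ℝ} (hs : 0 < s)
    {B : ℝ≥0∞} (hB : ∀ t ∈ Set.Icc s (2 * s) ∩ Set.Iic T, ρ t ≤ B * ENNReal.ofReal s) :
    scaleIntegral q ρ (Set.Icc s (2 * s) ∩ Set.Iic T) ≤ B ^ q := by
  have hs0 : ENNReal.ofReal s ≠ 0 := by simpa using hs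
  calc scaleIntegral q ρ (Set.Icc s (2 * s) ∩ Set.Iic T)
      ≤ ∫⁻ _ in Set.Icc s (2 * s) ∩ Set.Iic T, B ^ q / ENNReal.ofReal s := by
        refine setLIntegral_mono' (measurableSet_Icc.inter measurableSet_Iic) fun t ht => ?_
        have hst : ENNReal.ofReal s ≤ ENNReal.ofReal t := ENNReal.ofReal_le_ofReal ht.1.1
        refine ENNReal.div_le_div (ENNReal.rpow_le_rpow ?_ hq.le) hst
        exact ENNReal.div_le_of_le_mul ((hB t ht).trans (by gcongr))
    _ = B ^ q / ENNReal.ofReal s * volume (Set.Icc s (2 * s) ∩ Set.Iic T) := setLIntegral_const _ _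
    _ ≤ B ^ q / ENNReal.ofReal s * ENNReal.ofReal s := by
        gcongr
        refine (measure_mono Set.inter_subset_left).trans (le_of_eq ?_)
        rw [Real.volume_Icc]; congr 1; ring
    _ = B ^ q := ENNReal.div_mul_cancel hs0 ENNReal.ofReal_ne_top

theorem scaleIntegral_mono_set {q : ℝ} {ρ : ℝ → ℝ≥0∞} {s t : Set ℝ} (h : s ⊆ t) :
    scaleIntegral q ρ s ≤ scaleIntegral q ρ t := lintegral_mono_set h

theorem scaleIntegral_le_sum {q : ℝ} (hq : 0 < q) {ρ : ℝ → ℝ≥0∞} {T : ℝ} {n : ℕ}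
    (hT : T < 2 ^ n) (B : ℕ → ℝ≥0∞)
    (hB : ∀ k < n, ∀ t, 2 ^ k ≤ t → t ≤ 2 ^ (k + 1) → t ≤ T → ρ t ≤ B k * ENNReal.ofReal (2 ^ k)) :
    scaleIntegral q ρ (Set.Icc 1 T) ≤ ∑ k ∈ Finset.range n, B k ^ q := by
  have hsub : Set.Icc 1 T ⊆
      ⋃ k : Fin n, Set.Icc ((2 : ℝ) ^ (k : ℕ)) (2 * 2 ^ (k : ℕ)) ∩ Set.Iic T := by
    intro t ht
    obtain ⟨k, hk1, hk2⟩ := exists_nat_pow_near ht.1 (one_lt_two (α := ℝ))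
    have hkn : k < n := by
      by_contra hcon
      have := pow_le_pow_right₀ (one_le_two (α := ℝ)) (not_lt.1 hcon)
      linarith [ht.2]
    exact Set.mem_iUnion.2 ⟨⟨k, hkn⟩, ⟨hk1, by rw [← pow_succ']; exact hk2.le⟩, ht.2⟩
  refine (scaleIntegral_mono_set hsub).trans ((lintegral_iUnion_le _ _).trans ?_)
  rw [tsum_fintype, ← Fin.sum_univ_eq_sum_range fun k => B k ^ q]
  refine Finset.sum_le_sum fun k _ => scaleIntegral_dyadic_le hq (by positivity) fun t ht => ?_
  exact hB k k.2 t ht.1.1 (by rw [pow_succ']; exact ht.1.2) ht.2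

/-- The bound for the scale integral of the compression of a map on a binary tree. -/
noncomputable def treeConst (q a : ℝ) : ℝ := 2 ^ q / ballConvexityConst q a + 2 * 4 ^ q

theorem treeConst_pos {q a : ℝ} (ha : 0 < a) : 0 < treeConst q a := by
  have := ballConvexityConst_pos (q := q) ha
  unfold treeConst
  positivity

theorem UniformlyConvexWith.scaleIntegral_le {q a : ℝ} (hq : 1 < q) (ha : 0 < a)
    {X : Type*} [NormedAddCommGroup X] [NormedSpace ℝ X] (hX : UniformlyConvexWith q a X)
    {J : ℕ} {F : RootedBinaryTree J → X} (hF : LipschitzWith 1 F) :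
    scaleIntegral q (compression F) (Set.Icc 1 (2 * (J : ℝ))) ≤ ENNReal.ofReal (treeConst q a) := by
  have hc := ballConvexityConst_pos (q := q) ha
  rcases Nat.eq_zero_or_pos J with rfl | hJ
  · simp [scaleIntegral]
  set K := Nat.log 2 J
  have hK : 2 ^ K ≤ J := Nat.pow_log_le_self 2 hJ.ne'
  have hK' : J < 2 ^ (K + 1) := Nat.lt_pow_succ_log_self one_lt_two J
  have hKr : (J : ℝ) < 2 ^ (K + 1) := by exact_mod_cast hK'
  set r : ℕ → ℝ := fun k => (compression F (2 ^ (k + 1))).toReal / 2 ^ (k + 1) with hrdef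
  have hr : ∀ k, 0 ≤ r k := fun k => by positivity
  have hfin : ∀ k < K, compression F (2 ^ (k + 1)) ≠ ∞ := fun k hk => by
    refine ne_top_of_le_ne_top ENNReal.ofReal_ne_top (compression_rootedBinaryTree_le hF ?_)
    have h1 : (2 : ℝ) ^ (k + 1) ≤ 2 ^ K := pow_le_pow_right₀ one_le_two hk
    have h2 : (2 : ℝ) ^ K ≤ J := by exact_mod_cast hK
    have h3 : (0 : ℝ) < 2 ^ (k + 1) := by positivity
    linarith
  have hsum := hX.sum_tree_le hq ha hK hF r hr (fun k hk x y hxy => by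
    rw [hrdef]
    simp only
    rw [div_mul_cancel₀ _ (by positivity), ← dist_eq_norm, ← ENNReal.ofReal_le_ofReal_iff dist_nonneg,
      ENNReal.ofReal_toReal (hfin k hk), ← edist_dist]
    exact compression_le F hxy)
  have hint := scaleIntegral_le_sum (q := q) (by linarith) (ρ := compression F) (T := 2 * J)
    (n := K + 2) (by rw [pow_succ']; linarith)
    -- the two scales beyond `2 ^ K` are not seen by forks; there the diameter `2 * J` is used
    (fun k => if k < K then ENNReal.ofReal (2 * r k) else ENNReal.ofReal 4) (by
      intro k hk t ht1 ht2 ht3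
      split_ifs with hkK
      · refine (compression_mono F ht2).trans (le_of_eq ?_)
        rw [← ENNReal.ofReal_mul (by have := hr k; positivity), ← ENNReal.ofReal_toReal (hfin k hkK)]
        congr 1
        rw [hrdef]
        simp only
        rw [pow_succ]
        field_simp
      · refine (compression_rootedBinaryTree_le hF ht3).trans ?_
        rw [← ENNReal.ofReal_mul (by norm_num)]
        refine ENNReal.ofReal_le_ofReal ?_
        have := pow_le_pow_right₀ (one_le_two (α := ℝ)) (not_lt.1 hkK)
        rw [pow_succ] at hKr
        linarith)
  refine hint.trans ?_
  have hq0 : 0 ≤ q := by linarith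
  rw [Finset.sum_range_succ, Finset.sum_range_succ, if_neg (lt_irrefl K), if_neg (by omega),
    Finset.sum_congr rfl (g := fun k => ENNReal.ofReal ((2 * r k) ^ q)) (fun k hk => by
      rw [if_pos (Finset.mem_range.1 hk),
        ENNReal.ofReal_rpow_of_nonneg (by have := hr k; positivity) hq0]),
    ← ENNReal.ofReal_sum_of_nonneg (fun k _ => by have := hr k; positivity),
    ENNReal.ofReal_rpow_of_nonneg (by norm_num) hq0,
    ← ENNReal.ofReal_add (Finset.sum_nonneg fun k _ => by have := hr k; positivity) (by positivity),
    ← ENNReal.ofReal_add (add_nonneg (Finset.sum_nonneg fun k _ => by have := hr k; positivity)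
      (by positivity)) (by positivity)]
  refine ENNReal.ofReal_le_ofReal ?_
  have e : ∑ k ∈ Finset.range K, (2 * r k) ^ q = 2 ^ q * ∑ k ∈ Finset.range K, r k ^ q := by
    rw [Finset.mul_sum]
    exact Finset.sum_congr rfl fun k _ => Real.mul_rpow (by norm_num) (hr k)
  have h1 : ∑ k ∈ Finset.range K, r k ^ q ≤ 1 / ballConvexityConst q a := by
    rw [le_div_iff₀ hc, mul_comm]; exact hsum
  have h2 := mul_le_mul_of_nonneg_left h1 (show (0 : ℝ) ≤ 2 ^ q by positivity)
  rw [e, treeConst]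
  rw [mul_one_div] at h2
  linarith

theorem UniformlyConvexWith.exists_div_dist_le {q a : ℝ} (hq : 1 < q) (ha : 0 < a)
    {X : Type*} [NormedAddCommGroup X] [NormedSpace ℝ X] (hX : UniformlyConvexWith q a X)
    {J : ℕ} (hJ : 2 ≤ J) {F : RootedBinaryTree J → X} (hF : LipschitzWith 1 F) :
    ∃ x y : RootedBinaryTree J, x ≠ y ∧
      ‖F x - F y‖ / dist x y ≤ (treeConst q a / Real.log J) ^ (1 / q) := by
  have hc := ballConvexityConst_pos (q := q) ha
  have hC : 2 / ballConvexityConst q a ≤ treeConst q a := by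
    have h1 : (2 : ℝ) ≤ 2 ^ q := by simpa using Real.rpow_le_rpow_of_exponent_le one_le_two hq.le
    have h2 : 2 / ballConvexityConst q a ≤ 2 ^ q / ballConvexityConst q a := by gcongr
    have h3 : (0 : ℝ) ≤ 2 * 4 ^ q := by positivity
    rw [treeConst]; linarith
  have hlog : 0 < Real.log J := Real.log_pos (by exact_mod_cast hJ)
  have hK : 2 ^ Nat.log 2 J ≤ J := Nat.pow_log_le_self 2 (by omega)
  have hK1 : 1 ≤ Nat.log 2 J := Nat.log_pos one_lt_two hJ
  have hKlog : Real.log J < 2 * Nat.log 2 J := by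
    have h1 : (J : ℝ) < 2 ^ (Nat.log 2 J + 1) := by
      exact_mod_cast Nat.lt_pow_succ_log_self one_lt_two J
    have h2 := Real.log_lt_log (by positivity) h1
    rw [Real.log_pow] at h2
    have h3 : Real.log 2 < 1 := by linarith [Real.log_two_lt_d9]
    have h4 : (1 : ℝ) ≤ Nat.log 2 J := by exact_mod_cast hK1
    push_cast at h2
    nlinarith
  by_contra! hcon
  have hC0 : 0 < treeConst q a := lt_of_lt_of_le (by positivity) hC
  have hsum := hX.sum_tree_le hq ha hK hF (fun _ => (treeConst q a / Real.log J) ^ (1 / q))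
    (fun _ => by positivity) (fun k hk x y hxy => by
      have hpos : (0 : ℝ) < 2 ^ (k + 1) := by positivity
      have hd : 0 < dist x y := hpos.trans_le hxy
      have h1 := hcon x y (dist_pos.1 hd)
      rw [lt_div_iff₀ hd] at h1
      exact (mul_le_mul_of_nonneg_left hxy (by positivity)).trans h1.le)
  rw [Finset.sum_const, Finset.card_range, nsmul_eq_mul, ← Real.rpow_mul (by positivity),
    one_div_mul_cancel (by linarith), Real.rpow_one] at hsum
  have h1 : 2 ≤ ballConvexityConst q a * treeConst q a := by
    rw [div_le_iff₀ hc] at hC; linarith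
  have h2 : ballConvexityConst q a * (Nat.log 2 J * (treeConst q a / Real.log J)) =
      ballConvexityConst q a * treeConst q a * Nat.log 2 J / Real.log J := by ring
  rw [h2, div_le_one hlog] at hsum
  have h3 := mul_le_mul_of_nonneg_right h1 (Nat.cast_nonneg (α := ℝ) (Nat.log 2 J))
  linarith

/-! ### The regular tree of degree three -/

/-- Injective homomorphisms into trees are isometric, because they map paths to paths and paths in
trees are geodesics. -/
theorem SimpleGraph.IsTree.dist_map_of_injective {V W : Type*} {G : SimpleGraph W}
    {T : SimpleGraph V} (hT : T.IsTree) (hG : G.Connected) (f : G →g T)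
    (hf : Function.Injective f) (u v : W) : T.dist (f u) (f v) = G.dist u v := by
  obtain ⟨p, hp, hpl⟩ := hG.exists_path_of_dist u v
  obtain ⟨p', hp', hpl'⟩ := hT.connected.exists_path_of_dist (f u) (f v)
  have h := congrArg Subtype.val ((hT.isAcyclic.subsingleton_path _ _).elim
    ⟨p', hp'⟩ ⟨p.map f, hp.map hf⟩)
  simp only at h
  rw [← hpl', ← hpl, h, SimpleGraph.Walk.length_map]

theorem SimpleGraph.IsTree.parent_unique {V : Type*} {T : SimpleGraph V} (hT : T.IsTree)
    {v x y z : V} (hx : T.Adj x z) (hy : T.Adj y z) (hxz : T.dist v z = T.dist v x + 1)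
    (hyz : T.dist v z = T.dist v y + 1) : x = y := by
  obtain ⟨p, hp⟩ := hT.connected.exists_walk_length_eq_dist v x
  obtain ⟨p', hp'⟩ := hT.connected.exists_walk_length_eq_dist v y
  have h1 : (p.concat hx).IsPath := SimpleGraph.Walk.isPath_of_length_eq_dist _ (by
    rw [SimpleGraph.Walk.length_concat, hp, hxz])
  have h2 : (p'.concat hy).IsPath := SimpleGraph.Walk.isPath_of_length_eq_dist _ (by
    rw [SimpleGraph.Walk.length_concat, hp', hyz])
  have h := congrArg Subtype.val ((hT.isAcyclic.subsingleton_path _ _).elim ⟨_, h1⟩ ⟨_, h2⟩)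
  exact (SimpleGraph.Walk.concat_inj h).1

/-- At most one of the three neighbours of `v` is closer to `v₀` than `v`; two others are farther. -/
theorem SimpleGraph.IsTree.exists_children {V : Type*} {T : SimpleGraph V} [T.LocallyFinite]
    (hT : T.IsTree) (hreg : T.IsRegularOfDegree 3) (v₀ v : V) :
    ∃ c : Bool → V, Function.Injective c ∧
      ∀ b, T.Adj (c b) v ∧ T.dist v₀ (c b) = T.dist v₀ v + 1 := by
  classical
  set S := (T.neighborFinset v).filter fun w => T.dist v₀ w = T.dist v₀ v + 1
  set P := (T.neighborFinset v).filter fun w => ¬ T.dist v₀ w = T.dist v₀ v + 1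
  have hP : P.card ≤ 1 := by
    refine Finset.card_le_one.2 fun x hx y hy => ?_
    rw [Finset.mem_filter, SimpleGraph.mem_neighborFinset] at hx hy
    exact hT.parent_unique hx.1.symm hy.1.symm
      ((hT.dist_eq_dist_add_one_of_adj v₀ hx.1).resolve_right hx.2)
      ((hT.dist_eq_dist_add_one_of_adj v₀ hy.1).resolve_right hy.2)
  have hcard : S.card + P.card = 3 := by
    rw [Finset.card_filter_add_card_filter_not, SimpleGraph.card_neighborFinset_eq_degree]
    exact hreg v
  obtain ⟨x, hx, y, hy, hxy⟩ := Finset.one_lt_card.1 (show 1 < S.card by omega)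
  rw [Finset.mem_filter, SimpleGraph.mem_neighborFinset] at hx hy
  refine ⟨fun b => cond b x y, fun b b' => ?_, fun b => ?_⟩
  · cases b <;> cases b' <;> simp [hxy, hxy.symm]
  · cases b
    · exact ⟨hy.1.symm, hy.2⟩
    · exact ⟨hx.1.symm, hx.2⟩

theorem SimpleGraph.IsTree.exists_binary_subtree {V : Type*} {T : SimpleGraph V} [T.LocallyFinite]
    (hT : T.IsTree) (hreg : T.IsRegularOfDegree 3) :
    ∃ ι : List Bool → V, Function.Injective ι ∧ ∀ b l, T.Adj (ι (b :: l)) (ι l) := by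
  obtain ⟨v₀⟩ := hT.connected.nonempty
  choose c hinj hc using hT.exists_children hreg v₀
  let ι : List Bool → V := fun l => l.foldr (fun b v => c v b) v₀
  have hdist : ∀ l, T.dist v₀ (ι l) = l.length := fun l => by
    induction l with
    | nil => exact SimpleGraph.dist_self
    | cons b l ih => rw [List.length_cons, ← ih]; exact (hc (ι l) b).2
  refine ⟨ι, fun l l' h => ?_, fun b l => (hc (ι l) b).1⟩
  have hlen : l.length = l'.length := by rw [← hdist, ← hdist, h]
  induction l generalizing l' with
  | nil => exact (List.length_eq_zero_iff.1 hlen.symm).symm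
  | cons b l ih =>
    obtain _ | ⟨b', l'⟩ := l'
    · simp at hlen
    have hpar : ι l = ι l' := by
      refine hT.parent_unique (hc (ι l) b).1.symm (z := c (ι l) b) ?_ (hc (ι l) b).2 ?_
      · rw [show c (ι l) b = c (ι l') b' from h]; exact (hc (ι l') b').1.symm
      · rw [show c (ι l) b = c (ι l') b' from h]; exact (hc (ι l') b').2
    have hl := ih l' hpar (by simpa using hlen)
    subst hl
    rw [hinj (ι l) (show c (ι l) b = c (ι l) b' from h)]

/-- A `3`-regular tree contains isometric copies of all binary rooted trees. -/
theorem exists_isometry_rootedBinaryTree {V : Type*} {T : SimpleGraph V}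
    [T.LocallyFinite] (hT : T.IsTree) (hreg : T.IsRegularOfDegree 3) (J : ℕ) :
    ∃ f : RootedBinaryTree J → V, ∀ x y, (T.dist (f x) (f y) : ℝ) = dist x y := by
  obtain ⟨ι, hinj, hadj⟩ := hT.exists_binary_subtree hreg
  let f : rootedBinaryTreeGraph J →g T :=
    { toFun := fun x => ι x.1
      map_rel' := fun {u v} huv => by
        rcases ((SimpleGraph.fromRel_adj _ _ _).1 huv).2 with ⟨b, hb⟩ | ⟨b, hb⟩
        · rw [hb]; exact (hadj b _).symm
        · rw [hb]; exact hadj b _ }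
  refine ⟨f, fun x y => ?_⟩
  rw [hT.dist_map_of_injective (rootedBinaryTreeGraph_connected J) f
    (fun x y h => Subtype.ext (hinj h)), RootedBinaryTree.dist_eq]

/-- Otherwise the image distances of some pairs at distance at most `R` would tend to infinity. -/
theorem IsUniformEmbeddingLS.exists_dist_le {V Y : Type*} [PseudoMetricSpace V]
    [PseudoMetricSpace Y] {F : V → Y} (hF : IsUniformEmbeddingLS F) (R : ℝ) :
    ∃ L : ℝ, 0 < L ∧ ∀ u v, dist u v ≤ R → dist (F u) (F v) ≤ L := by
  by_contra! hcon
  choose u v huv hF' using fun n : ℕ => hcon (n + 1) (by positivity)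
  have h1 : Tendsto (fun n => dist (F (u n)) (F (v n))) atTop atTop :=
    tendsto_atTop_mono (fun n => ((lt_add_one _).trans (hF' n)).le) tendsto_natCast_atTop_atTop
  obtain ⟨n, hn⟩ := (((hF u v).2 h1).eventually_gt_atTop R).exists
  exact absurd (huv n) (not_le.2 hn)

theorem scaleIntegral_const_mul {q : ℝ} (hq : 0 ≤ q) {k : ℝ≥0∞} (hk : k ≠ ∞) (ρ : ℝ → ℝ≥0∞)
    (s : Set ℝ) : scaleIntegral q (fun t => k * ρ t) s = k ^ q * scaleIntegral q ρ s := by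
  rw [scaleIntegral, scaleIntegral, ← lintegral_const_mul' _ _ (ENNReal.rpow_ne_top_of_nonneg hq hk)]
  refine lintegral_congr fun t => ?_
  rw [mul_div_assoc, ENNReal.mul_rpow_of_nonneg _ _ hq, mul_div_assoc]

theorem scaleIntegral_mono {q : ℝ} (hq : 0 ≤ q) {ρ ρ' : ℝ → ℝ≥0∞} (h : ∀ t, ρ t ≤ ρ' t)
    (s : Set ℝ) : scaleIntegral q ρ s ≤ scaleIntegral q ρ' s :=
  lintegral_mono fun t =>
    ENNReal.div_le_div_right (ENNReal.rpow_le_rpow (ENNReal.div_le_div_right (h t) _) hq) _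

theorem scaleIntegral_Ici_le {q : ℝ} {ρ : ℝ → ℝ≥0∞} {C : ℝ≥0∞}
    (h : ∀ J : ℕ, scaleIntegral q ρ (Set.Icc 1 (2 * (J : ℝ))) ≤ C) :
    scaleIntegral q ρ (Set.Ici 1) ≤ C := by
  have hU : Set.Ici (1 : ℝ) = ⋃ J : ℕ, Set.Icc 1 (2 * (J : ℝ)) := by
    ext t
    simp only [Set.mem_Ici, Set.mem_iUnion, Set.mem_Icc]
    refine ⟨fun ht => ?_, fun ⟨_, ht⟩ => ht.1⟩
    obtain ⟨J, hJ⟩ := exists_nat_ge t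
    exact ⟨J, ht, by linarith⟩
  have hdir : Directed (· ⊆ ·) fun J : ℕ => Set.Icc (1 : ℝ) (2 * (J : ℝ)) :=
    Monotone.directed_le fun i j hij => Set.Icc_subset_Icc_right (by gcongr)
  rw [scaleIntegral, hU, setLIntegral_iUnion_of_directed _ hdir]
  exact iSup_le h

theorem QUniformlyConvex.conditionC {q : ℝ} (hq : 1 < q) {X : Type*} [NormedAddCommGroup X]
    [NormedSpace ℝ X] (hX : QUniformlyConvex q X) {V : Type*} [MetricSpace V] {T : SimpleGraph V}
    [T.LocallyFinite] (hT : T.IsTree) (hreg : T.IsRegularOfDegree 3)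
    (hd : ∀ u v : V, dist u v = (T.dist u v : ℝ)) {F : V → X} (hF : IsUniformEmbeddingLS F) :
    ConditionC q (compression F) := by
  obtain ⟨a, ha, hX⟩ := hX
  have hq0 : 0 ≤ q := by linarith
  obtain ⟨L, hL, hLF⟩ := hF.exists_dist_le 1
  have hlip : ∀ u v, dist (F u) (F v) ≤ L * dist u v := fun u v => by
    rw [hd]
    refine dist_map_le_of_adj hT.connected (fun u v huv => hLF u v ?_) u v
    rw [hd, SimpleGraph.dist_eq_one_iff_adj.2 huv, Nat.cast_one]
  have hk : ENNReal.ofReal L⁻¹ ≠ 0 := by simpa using hL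
  have key : scaleIntegral q (fun t => ENNReal.ofReal L⁻¹ * compression F t) (Set.Ici 1) ≤
      ENNReal.ofReal (treeConst q a) := by
    refine scaleIntegral_Ici_le fun J => ?_
    obtain ⟨f, hf⟩ := exists_isometry_rootedBinaryTree hT hreg J
    have hG : LipschitzWith 1 fun x => L⁻¹ • F (f x) := LipschitzWith.of_dist_le_mul fun x y => by
      rw [dist_smul₀, Real.norm_of_nonneg (by positivity), NNReal.coe_one, one_mul,
        inv_mul_le_iff₀ hL, ← hf, ← hd]
      exact hlip _ _
    refine (scaleIntegral_mono hq0 (fun t => ?_) _).trans (hX.scaleIntegral_le hq ha hG)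
    refine le_iInf fun x => le_iInf fun y => le_iInf fun hxy => ?_
    rw [edist_dist, dist_smul₀, Real.norm_of_nonneg (by positivity),
      ENNReal.ofReal_mul (by positivity), ← edist_dist]
    gcongr
    exact compression_le F (by rwa [hd, hf])
  rw [scaleIntegral_const_mul hq0 ENNReal.ofReal_ne_top] at key
  refine ENNReal.lt_top_of_mul_ne_top_right (ne_top_of_le_ne_top ENNReal.ofReal_ne_top key) ?_
  rw [Ne, ENNReal.rpow_eq_zero_iff]
  rintro (h | h)
  · exact hk h.1
  · exact ENNReal.ofReal_ne_top h.1

/-! ### Uniform convexity of `L^p`-spaces -/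

/-- The pointwise form of Clarkson's inequality. Here, and in the case `p ≤ 2` below, `u`, `v`, `m`
and `d` stand for the norms of `a`, `b`, `(a + b) / 2` and `(a - b) / 2` in an inner product space. -/
theorem clarkson_of_two_le {p u v m d : ℝ} (hp : 2 ≤ p) (hu : 0 ≤ u) (hv : 0 ≤ v) (hm : 0 ≤ m)
    (hd : 0 ≤ d) (h : m ^ 2 + d ^ 2 = (u ^ 2 + v ^ 2) / 2) :
    m ^ p + d ^ p ≤ (u ^ p + v ^ p) / 2 := by
  have hsq : ∀ x : ℝ, 0 ≤ x → x ^ p = (x ^ 2) ^ (p / 2) := fun x hx => by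
    rw [← Real.rpow_natCast, ← Real.rpow_mul hx]
    congr 1
    push_cast; ring
  have hp' : 1 ≤ p / 2 := by linarith
  have h1 := Real.add_rpow_le_rpow_add (sq_nonneg m) (sq_nonneg d) hp'
  have h2 := (convexOn_rpow hp').2 (Set.mem_Ici.2 (sq_nonneg u)) (Set.mem_Ici.2 (sq_nonneg v))
    (show (0 : ℝ) ≤ 1 / 2 by norm_num) (show (0 : ℝ) ≤ 1 / 2 by norm_num) (by norm_num)
  simp only [smul_eq_mul] at h2
  rw [hsq u hu, hsq v hv, hsq m hm, hsq d hd]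
  rw [h, show (u ^ 2 + v ^ 2) / 2 = 1 / 2 * u ^ 2 + 1 / 2 * v ^ 2 by ring] at h1
  linarith

/-- Strong convexity of `x ^ p` on `[0, M]`, in the form of convexity after subtraction of a
quadratic function. -/
theorem convexOn_rpow_sub_sq {p M : ℝ} (hp1 : 1 < p) (hp2 : p ≤ 2) :
    ConvexOn ℝ (Set.Icc 0 M) fun x => x ^ p - p * (p - 1) / 2 * M ^ (p - 2) * x ^ 2 := by
  set c := p * (p - 1) / 2 * M ^ (p - 2) with hc
  refine convexOn_of_hasDerivWithinAt2_nonneg (convex_Icc 0 M)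
    (f' := fun x => p * x ^ (p - 1) - c * (2 * x))
    (f'' := fun x => p * ((p - 1) * x ^ (p - 2)) - c * 2) ?_ ?_ ?_ ?_
  · exact (ContinuousOn.rpow_const continuousOn_id fun x _ => Or.inr (by linarith)).sub
      (by fun_prop)
  · intro x hx
    rw [interior_Icc] at hx
    refine ((Real.hasDerivAt_rpow_const (Or.inl hx.1.ne')).sub ?_).hasDerivWithinAt
    simpa using (hasDerivAt_pow 2 x).const_mul c
  · intro x hx
    rw [interior_Icc] at hx
    have h1 := (Real.hasDerivAt_rpow_const (x := x) (p := p - 1) (Or.inl hx.1.ne')).const_mul p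
    rw [show p - 1 - 1 = p - 2 by ring] at h1
    refine (h1.sub ?_).hasDerivWithinAt
    simpa using ((hasDerivAt_id x).const_mul 2).const_mul c
  · intro x hx
    rw [interior_Icc] at hx
    have h1 : M ^ (p - 2) ≤ x ^ (p - 2) :=
      Real.rpow_le_rpow_of_nonpos hx.1 hx.2.le (by linarith)
    have h2 := mul_le_mul_of_nonneg_left h1 (show 0 ≤ p * (p - 1) by nlinarith)
    rw [hc]
    linarith

/-- Quantitative convexity of the `p`-th power of a Euclidean norm for `1 < p ≤ 2`. The defect
splits into a radial part, which strong convexity of `x ^ p` controls, and the remaining angular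
part `d ^ 2 - (u - v) ^ 2 / 4`, which Bernoulli's inequality controls. -/
theorem rpow_add_sq_le_of_le_two {p u v m d : ℝ} (hp1 : 1 < p) (hp2 : p ≤ 2) (hu : 0 ≤ u)
    (hv : 0 ≤ v) (hM : 0 < u + v) (hm : 0 ≤ m) (hd : |u - v| / 2 ≤ d)
    (h : m ^ 2 + d ^ 2 = (u ^ 2 + v ^ 2) / 2) :
    m ^ p + p * (p - 1) / 2 * (u + v) ^ (p - 2) * d ^ 2 ≤ (u ^ p + v ^ p) / 2 := by
  set M := u + v with hMdef
  set c := p * (p - 1) / 2 * M ^ (p - 2) with hc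
  have hrad := (convexOn_rpow_sub_sq (M := M) hp1 hp2).2 (x := u) (y := v) ⟨hu, by linarith⟩
    ⟨hv, by linarith⟩ (show (0 : ℝ) ≤ 1 / 2 by norm_num) (show (0 : ℝ) ≤ 1 / 2 by norm_num)
    (by norm_num)
  simp only [smul_eq_mul] at hrad
  rw [← hc, show 1 / 2 * u + 1 / 2 * v = M / 2 by rw [hMdef]; ring] at hrad
  set η := d ^ 2 - (u - v) ^ 2 / 4 with hη
  have hη0 : 0 ≤ η := by
    have := pow_le_pow_left₀ (by positivity) hd 2
    rw [div_pow, sq_abs] at this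
    rw [hη]; linarith
  have hmη : m ^ 2 = (M / 2) ^ 2 * (1 + -(η / (M / 2) ^ 2)) := by
    have : (M / 2) ^ 2 * (η / (M / 2) ^ 2) = η := mul_div_cancel₀ _ (by positivity)
    rw [mul_add, mul_neg, this, hη, hMdef]
    linarith
  have hs : -1 ≤ -(η / (M / 2) ^ 2) := by
    have h1 : 0 ≤ (M / 2) ^ 2 * (1 + -(η / (M / 2) ^ 2)) := hmη ▸ sq_nonneg m
    linarith [nonneg_of_mul_nonneg_right h1 (by positivity)]
  have hang : m ^ p ≤ (M / 2) ^ p - c * η := by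
    have h1 := rpow_one_add_le_one_add_mul_self hs (p := p / 2) (by linarith) (by linarith)
    have hsq : ∀ x : ℝ, 0 ≤ x → x ^ p = (x ^ 2) ^ (p / 2) := fun x hx => by
      rw [← Real.rpow_natCast, ← Real.rpow_mul hx]
      congr 1
      push_cast; ring
    have h2 : m ^ p ≤ (M / 2) ^ p * (1 + p / 2 * -(η / (M / 2) ^ 2)) := by
      rw [hsq m hm, hmη, Real.mul_rpow (by positivity) (by linarith), ← hsq (M / 2) (by positivity)]
      gcongr
    have h3 : (M / 2) ^ p * (1 + p / 2 * -(η / (M / 2) ^ 2)) =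
        (M / 2) ^ p - p / 2 * (M / 2) ^ (p - 2) * η := by
      rw [Real.rpow_sub (by positivity), Real.rpow_two]; ring
    have h4 : M ^ (p - 2) ≤ (M / 2) ^ (p - 2) :=
      Real.rpow_le_rpow_of_nonpos (by positivity) (by linarith) (by linarith)
    have h5 : c ≤ p / 2 * (M / 2) ^ (p - 2) :=
      mul_le_mul (by nlinarith) h4 (by positivity) (by positivity)
    have h6 := mul_le_mul_of_nonneg_right h5 hη0
    linarith
  have h7 : c * (M / 2) ^ 2 + c * η + c * (u - v) ^ 2 / 4 = c * (M / 2) ^ 2 + c * d ^ 2 := by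
    rw [hη]; ring
  have h8 : 1 / 2 * (c * u ^ 2) + 1 / 2 * (c * v ^ 2) - c * (M / 2) ^ 2 = c * (u - v) ^ 2 / 4 := by
    rw [hMdef]; ring
  linarith

/-- A homogeneous form of `rpow_add_sq_le_of_le_two` in which only `p`-th powers occur: the factor
`(u + v) ^ (p - 2)` is removed by distinguishing whether `d` is small relative to `u + v`. -/
theorem rpow_le_of_le_two {p u v m d τ : ℝ} (hp1 : 1 < p) (hp2 : p ≤ 2) (hτ : 0 < τ) (hu : 0 ≤ u)
    (hv : 0 ≤ v) (hm : 0 ≤ m) (hd : |u - v| / 2 ≤ d) (h : m ^ 2 + d ^ 2 = (u ^ 2 + v ^ 2) / 2) :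
    d ^ p ≤ (τ ^ p * 2 ^ (p - 1) + τ ^ (p - 2) / (p * (p - 1) / 2) / 2) * (u ^ p + v ^ p) -
      τ ^ (p - 2) / (p * (p - 1) / 2) * m ^ p := by
  have hd0 : 0 ≤ d := (by positivity : 0 ≤ |u - v| / 2).trans hd
  rcases (add_nonneg hu hv).eq_or_lt with hM | hM
  · obtain rfl : u = 0 := by linarith
    obtain rfl : v = 0 := by linarith
    obtain rfl : m = 0 := by nlinarith [sq_nonneg m, sq_nonneg d]
    obtain rfl : d = 0 := by nlinarith [sq_nonneg d]
    simp [Real.zero_rpow (show p ≠ 0 by linarith)]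
  have hc : 0 < p * (p - 1) / 2 := by nlinarith
  have hconv := rpow_add_sq_le_of_le_two hp1 hp2 hu hv hM hm hd h
  have hMp : (u + v) ^ p ≤ 2 ^ (p - 1) * (u ^ p + v ^ p) := by
    lift u to ℝ≥0 using hu
    lift v to ℝ≥0 using hv
    exact_mod_cast NNReal.rpow_add_le_mul_rpow_add_rpow u v hp1.le
  have hsplit : d ^ p ≤ τ ^ p * (u + v) ^ p + τ ^ (p - 2) * ((u + v) ^ (p - 2) * d ^ 2) := by
    rcases le_or_gt d (τ * (u + v)) with hle | hgt
    · have h1 : d ^ p ≤ (τ * (u + v)) ^ p := Real.rpow_le_rpow hd0 hle (by linarith)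
      rw [Real.mul_rpow hτ.le hM.le] at h1
      have h2 : 0 ≤ τ ^ (p - 2) * ((u + v) ^ (p - 2) * d ^ 2) := by positivity
      linarith
    · have hdpos : 0 < d := lt_trans (by positivity) hgt
      have h1 : d ^ (p - 2) ≤ (τ * (u + v)) ^ (p - 2) :=
        Real.rpow_le_rpow_of_nonpos (by positivity) hgt.le (by linarith)
      rw [Real.mul_rpow hτ.le hM.le] at h1
      have h2 : d ^ p = d ^ (p - 2) * d ^ 2 := by
        rw [← Real.rpow_two, ← Real.rpow_add hdpos]; congr 1; ring
      have h3 := mul_le_mul_of_nonneg_right h1 (sq_nonneg d)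
      have h4 : 0 ≤ τ ^ p * (u + v) ^ p := by positivity
      rw [h2]; linarith
  have h1 : (u + v) ^ (p - 2) * d ^ 2 ≤ ((u ^ p + v ^ p) / 2 - m ^ p) / (p * (p - 1) / 2) := by
    rw [le_div_iff₀ hc]; linarith
  have h2 := mul_le_mul_of_nonneg_left h1 (show 0 ≤ τ ^ (p - 2) by positivity)
  have h3 := mul_le_mul_of_nonneg_left hMp (show 0 ≤ τ ^ p by positivity)
  have h4 : τ ^ (p - 2) * (((u ^ p + v ^ p) / 2 - m ^ p) / (p * (p - 1) / 2)) =
      τ ^ (p - 2) / (p * (p - 1) / 2) / 2 * (u ^ p + v ^ p) -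
        τ ^ (p - 2) / (p * (p - 1) / 2) * m ^ p := by ring
  linarith

section Lp

variable {𝕜 Ω : Type*} [RCLike 𝕜] [MeasurableSpace Ω] {μ : Measure Ω} {p : ℝ≥0∞}

theorem norm_half_add_sq_add_norm_half_sub_sq (a b : 𝕜) :
    ‖(1 / 2 : ℝ) • (a + b)‖ ^ 2 + ‖(1 / 2 : ℝ) • (a - b)‖ ^ 2 = (‖a‖ ^ 2 + ‖b‖ ^ 2) / 2 := by
  have h := parallelogram_law_with_norm 𝕜 a b
  rw [norm_smul, norm_smul, Real.norm_of_nonneg (by norm_num)]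
  linarith

theorem abs_norm_sub_norm_half_le (a b : 𝕜) : |‖a‖ - ‖b‖| / 2 ≤ ‖(1 / 2 : ℝ) • (a - b)‖ := by
  rw [norm_smul, Real.norm_of_nonneg (by norm_num)]
  linarith [abs_norm_sub_norm_le a b]

theorem Lp_norm_rpow (hp0 : p ≠ 0) (hp : p ≠ ∞) (f : Lp 𝕜 p μ) :
    ‖f‖ ^ p.toReal = ∫ x, ‖f x‖ ^ p.toReal ∂μ := by
  have hp' : 0 < p.toReal := ENNReal.toReal_pos hp0 hp
  have hint : 0 ≤ ∫ x, ‖f x‖ ^ p.toReal ∂μ := integral_nonneg fun x => by positivity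
  rw [Lp.norm_def, (Lp.memLp f).eLpNorm_eq_integral_rpow_norm hp0 hp,
    ENNReal.toReal_ofReal (by positivity), Real.rpow_inv_rpow hint hp'.ne']

theorem Lp_integrable_norm_rpow (hp0 : p ≠ 0) (hp : p ≠ ∞) (f : Lp 𝕜 p μ) :
    Integrable (fun x => ‖f x‖ ^ p.toReal) μ :=
  (Lp.memLp f).integrable_norm_rpow hp0 hp

/-- Inequalities between `p`-th powers of norms of sums and differences pass from scalars to
functions. -/
theorem Lp_norm_half_sub_rpow_le [Fact (1 ≤ p)] (hp : p ≠ ∞) {A B : ℝ}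
    (h : ∀ a b : 𝕜, ‖(1 / 2 : ℝ) • (a - b)‖ ^ p.toReal ≤
      A * (‖a‖ ^ p.toReal + ‖b‖ ^ p.toReal) - B * ‖(1 / 2 : ℝ) • (a + b)‖ ^ p.toReal)
    (f g : Lp 𝕜 p μ) :
    ‖(1 / 2 : ℝ) • (f - g)‖ ^ p.toReal ≤
      A * (‖f‖ ^ p.toReal + ‖g‖ ^ p.toReal) - B * ‖(1 / 2 : ℝ) • (f + g)‖ ^ p.toReal := by
  have hp0 : p ≠ 0 := (zero_lt_one.trans_le (Fact.out : 1 ≤ p)).ne'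
  have hf := Lp_integrable_norm_rpow hp0 hp f
  have hg := Lp_integrable_norm_rpow hp0 hp g
  have hfg : Integrable (fun x => ‖f x‖ ^ p.toReal + ‖g x‖ ^ p.toReal) μ := hf.add hg
  have hs := Lp_integrable_norm_rpow hp0 hp ((1 / 2 : ℝ) • (f + g))
  have hd := Lp_integrable_norm_rpow hp0 hp ((1 / 2 : ℝ) • (f - g))
  simp only [Lp_norm_rpow hp0 hp]
  rw [← integral_add hf hg, ← integral_const_mul, ← integral_const_mul,
    ← integral_sub (hfg.const_mul A) (hs.const_mul B)]
  refine integral_mono_ae hd ((hfg.const_mul A).sub (hs.const_mul B)) ?_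
  filter_upwards [Lp.coeFn_smul (1 / 2 : ℝ) (f + g), Lp.coeFn_smul (1 / 2 : ℝ) (f - g),
    Lp.coeFn_add f g, Lp.coeFn_sub f g] with x h1 h2 h3 h4
  simp only [h1, h2, h3, h4, Pi.smul_apply, Pi.add_apply, Pi.sub_apply]
  exact h _ _

end Lp

/-- Bernoulli's inequality, used to extract `p`-th roots. -/
theorem le_one_sub_div_of_rpow_le {p N x : ℝ} (hp : 1 ≤ p) (hN : 0 ≤ N) (h : N ^ p ≤ 1 - x) :
    N ≤ 1 - x / p := by
  have h1 := one_add_mul_self_le_rpow_one_add (s := N - 1) (by linarith) hp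
  rw [add_sub_cancel] at h1
  rw [le_sub_iff_add_le, ← le_sub_iff_add_le', div_le_iff₀ (by linarith)]
  linarith

/-- A constant of uniform convexity, of exponent `max p 2`, for all `L^p`-spaces. -/
noncomputable def lpConvexityConst (p : ℝ) : ℝ :=
  if 2 ≤ p then 1 / (p * 2 ^ p) else (p - 1) / 128

theorem lpConvexityConst_pos {p : ℝ} (hp : 1 < p) : 0 < lpConvexityConst p := by
  unfold lpConvexityConst
  split_ifs
  · positivity
  · linarith

theorem uniformlyConvexWith_Lp (p : ℝ≥0∞) [Fact (1 ≤ p)] (hp1 : 1 < p) (hp : p ≠ ∞)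
    (𝕜 : Type*) [RCLike 𝕜] (Ω : Type*) [MeasurableSpace Ω] (μ : Measure Ω) :
    UniformlyConvexWith (max p.toReal 2) (lpConvexityConst p.toReal) (Lp 𝕜 p μ) := by
  intro ε hε f g hf hg hfg
  have hp1' : 1 < p.toReal := by
    rw [← ENNReal.toReal_one]; exact (ENNReal.toReal_lt_toReal ENNReal.one_ne_top hp).2 hp1
  have hdiff : (ε / 2) ^ p.toReal ≤ ‖(1 / 2 : ℝ) • (f - g)‖ ^ p.toReal := by
    refine Real.rpow_le_rpow (by positivity) ?_ (by linarith)
    rw [norm_smul, Real.norm_of_nonneg (by norm_num)]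
    linarith
  rw [lpConvexityConst]
  split_ifs with h2
  · have h := Lp_norm_half_sub_rpow_le (μ := μ) hp (A := 1 / 2) (B := 1) (fun a b : 𝕜 => by
      have := clarkson_of_two_le h2 (norm_nonneg a) (norm_nonneg b) (norm_nonneg _) (norm_nonneg _)
        (norm_half_add_sq_add_norm_half_sub_sq a b)
      linarith) f g
    rw [hf, hg, Real.one_rpow] at h
    refine (le_one_sub_div_of_rpow_le hp1'.le (norm_nonneg _)
      (x := (ε / 2) ^ p.toReal) (by linarith)).trans (le_of_eq ?_)
    rw [max_eq_left h2, Real.div_rpow hε.le (by norm_num)]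
    field_simp
  · rw [not_le] at h2
    have hτ : 0 < ε / 8 := by positivity
    have hc : 0 < p.toReal * (p.toReal - 1) / 2 := by nlinarith
    have h := Lp_norm_half_sub_rpow_le (μ := μ) hp (fun a b : 𝕜 =>
      rpow_le_of_le_two hp1' h2.le hτ (norm_nonneg a) (norm_nonneg b) (norm_nonneg _)
        (abs_norm_sub_norm_half_le a b) (norm_half_add_sq_add_norm_half_sub_sq a b)) f g
    rw [hf, hg, Real.one_rpow] at h
    set P := p.toReal with hP
    set N := ‖(1 / 2 : ℝ) • (f + g)‖ with hN
    have e1 : (ε / 2) ^ P = 2 ^ P * 2 ^ P * (ε / 8) ^ P := by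
      rw [← Real.mul_rpow (by norm_num) (by norm_num), ← Real.mul_rpow (by norm_num) hτ.le]
      congr 1; ring
    have e2 : (2 : ℝ) ^ (P - 1) * 2 = 2 ^ P := by
      rw [Real.rpow_sub_one (by norm_num)]; ring
    have e3 : (ε / 8) ^ P = (ε / 8) ^ (P - 2) * (ε / 8) ^ 2 := by
      rw [← Real.rpow_two, ← Real.rpow_add hτ]; congr 1; ring
    have h2P : (2 : ℝ) ≤ 2 ^ P := by
      simpa using Real.rpow_le_rpow_of_exponent_le one_le_two hp1'.le
    have hτP : 0 < (ε / 8) ^ P := by positivity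
    have hτP2 : 0 < (ε / 8) ^ (P - 2) := by positivity
    -- the choice `τ = ε / 8` lets the first term absorb at most half of the left-hand side
    have h5 : (ε / 8) ^ P ≤ (ε / 8) ^ (P - 2) / (P * (P - 1) / 2) * (1 - N ^ P) := by
      have h6 : (ε / 8) ^ P * (2 ^ (P - 1) * 2) + (ε / 8) ^ P ≤ (ε / 2) ^ P := by
        rw [e1, e2]
        nlinarith [mul_le_mul_of_nonneg_right (show (2 : ℝ) ^ P + 1 ≤ 2 ^ P * 2 ^ P by nlinarith)
          hτP.le]
      linarith
    have h7 : P * (P - 1) / 2 * (ε / 8) ^ 2 ≤ 1 - N ^ P := by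
      rw [e3, div_mul_eq_mul_div, le_div_iff₀ hc, mul_assoc] at h5
      have := le_of_mul_le_mul_left h5 hτP2
      linarith
    refine (le_one_sub_div_of_rpow_le hp1'.le (norm_nonneg _)
      (x := P * (P - 1) / 2 * (ε / 8) ^ 2) (by linarith)).trans (le_of_eq ?_)
    rw [max_eq_right h2.le, Real.rpow_two]
    field_simp
    ring

theorem mainTheorem4 :
    -- finite trees: the constant depends only on `q` and on the convexity constant `a`
    (∀ q a : ℝ, 1 < q → 0 < a → ∃ C : ℝ≥0,
      ∀ (X : Type*) [NormedAddCommGroup X] [NormedSpace ℝ X] [CompleteSpace X],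
        UniformlyConvexWith q a X →
        ∀ (J : ℕ) (F : RootedBinaryTree J → X), LipschitzWith 1 F →
          scaleIntegral q (compression F) (Set.Icc 1 (2 * (J : ℝ))) ≤ C ∧
          (2 ≤ J → ∃ x y : RootedBinaryTree J, x ≠ y ∧
            ‖F x - F y‖ / dist x y ≤ ((C : ℝ) / Real.log J) ^ (1 / q))) ∧
    -- the 3-regular tree
    (∀ q : ℝ, 1 < q →
      ∀ (X : Type*) [NormedAddCommGroup X] [NormedSpace ℝ X] [CompleteSpace X],
        QUniformlyConvex q X →
        ∀ (V : Type*) [MetricSpace V] (T : SimpleGraph V) [T.LocallyFinite],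
          T.IsTree → T.IsRegularOfDegree 3 → (∀ u v : V, dist u v = (T.dist u v : ℝ)) →
          ∀ F : V → X, IsUniformEmbeddingLS F → ConditionC q (compression F)) ∧
    -- `L^p`-spaces are uniformly convex of exponent `max p 2`, with a constant depending only on `p`
    (∀ (p : ℝ≥0∞) [Fact (1 ≤ p)], 1 < p → p ≠ ∞ → ∃ a : ℝ, 0 < a ∧
      ∀ (𝕜 : Type*) [RCLike 𝕜] (Ω : Type*) [MeasurableSpace Ω] (μ : Measure Ω),
        UniformlyConvexWith (max p.toReal 2) a (Lp 𝕜 p μ)) ∧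
    -- finite trees in `L^p`-spaces: the constant depends only on `p`
    (∀ (p : ℝ≥0∞) [Fact (1 ≤ p)], 1 < p → p ≠ ∞ → ∃ C : ℝ≥0,
      ∀ (𝕜 : Type*) [RCLike 𝕜] (Ω : Type*) [MeasurableSpace Ω] (μ : Measure Ω)
        (J : ℕ) (F : RootedBinaryTree J → Lp 𝕜 p μ), LipschitzWith 1 F →
          scaleIntegral (max p.toReal 2) (compression F) (Set.Icc 1 (2 * (J : ℝ))) ≤ C) ∧
    -- the 3-regular tree in `L^p`-spaces
    (∀ (p : ℝ≥0∞) [Fact (1 ≤ p)], 1 < p → p ≠ ∞ →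
      ∀ (𝕜 : Type*) [RCLike 𝕜] (Ω : Type*) [MeasurableSpace Ω] (μ : Measure Ω)
        (V : Type*) [MetricSpace V] (T : SimpleGraph V) [T.LocallyFinite],
          T.IsTree → T.IsRegularOfDegree 3 → (∀ u v : V, dist u v = (T.dist u v : ℝ)) →
          ∀ F : V → Lp 𝕜 p μ, IsUniformEmbeddingLS F →
            ConditionC (max p.toReal 2) (compression F)) := by
  have hmax : ∀ p : ℝ≥0∞, 1 < max p.toReal 2 := fun p => one_lt_two.trans_le (le_max_right _ _)
  have hpos : ∀ p : ℝ≥0∞, 1 < p → p ≠ ∞ → 0 < lpConvexityConst p.toReal := fun p h1 h2 =>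
    lpConvexityConst_pos (by
      rw [← ENNReal.toReal_one]
      exact (ENNReal.toReal_lt_toReal ENNReal.one_ne_top h2).2 h1)
  refine ⟨fun q a hq ha => ⟨(treeConst q a).toNNReal, fun X _ _ _ hX J F hF =>
    ⟨hX.scaleIntegral_le hq ha hF, fun hJ => ?_⟩⟩, ?_, ?_, ?_, ?_⟩
  · rw [Real.coe_toNNReal _ (treeConst_pos ha).le]
    exact hX.exists_div_dist_le hq ha hJ hF
  · intro q hq X _ _ _ hX V _ T _ hT hreg hd F hF
    exact hX.conditionC hq hT hreg hd hF
  · intro p _ h1 h2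
    exact ⟨_, hpos p h1 h2, fun 𝕜 _ Ω _ μ => uniformlyConvexWith_Lp p h1 h2 𝕜 Ω μ⟩
  · intro p _ h1 h2
    exact ⟨_, fun 𝕜 _ Ω _ μ J F hF =>
      (uniformlyConvexWith_Lp p h1 h2 𝕜 Ω μ).scaleIntegral_le (hmax p) (hpos p h1 h2) hF⟩
  · intro p _ h1 h2 𝕜 _ Ω _ μ V _ T _ hT hreg hd F hF
    exact QUniformlyConvex.conditionC (hmax p)
      ⟨_, hpos p h1 h2, uniformlyConvexWith_Lp p h1 h2 𝕜 Ω μ⟩ hT hreg hd hF
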